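/- Let $V$ be a finite nonempty set of terminals, $G=(V,E)$ a directed mobility graph (an edge $(i,i)$ means that the agent may stay at $i$), and $w_i>0$ ($i\in V$) weights. A trajectory is a sequence $m(1),m(2),\dots$ in $V$ with $(m(t),m(t+1))\in E$ for all $t$. The age of terminal $i$ starts from an arbitrary value $A_i(1)\in\mathbb R$ and evolves by $A_i(t+1)=1$ if $m(t)=i$ and $A_i(t+1)=A_i(t)+1$ otherwise. The peak age of $i$ and the network peak age are $$A_i^{\mathrm p}(m)=\limsup_{T\to\infty}\frac{\sum_{t=1}^T A_i(t)\mathbf 1_{\{m(t)=i\}}}{\sum_{t=1}^T \mathbf 1_{\{m(t)=i\}}},\qquad A^{\mathrm p}(m)=\sum_{i\in V}w_iA_i^{\mathrm p}(m).$$ Let $\mathbb T$ be the set of trajectories for which $f_i=\lim_{T\to\infty}\frac1T\sum_{t=1}^T\mathbf 1_{\{m(t)=i\}}$ exists and is positive for every $i\in V$, let $A^{\mathrm p*}_{\mathcal G}=\inf_{m\in\mathbb T}A^{\mathrm p}(m)$, and let $\pi^*_i=\sqrt{w_i}/\sum_{j\in V}\sqrt{w_j}$. A randomized trajectory $\mathbf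 P$ on $G$ is an irreducible Markov chain on $V$, with any initial distribution, whose transition matrix $\mathbf P$ satisfies $P_{i,j}=0$ for $(i,j)\notin E$. 1. For every $m\in\mathbb T$, $A^{\mathrm p}(m)\ge\sum_{i\in V}w_i/\pi_i^*$. 2. If a randomized trajectory $\mathbf P$ on $G$ satisfies $\pi^*\mathbf P=\pi^*$, then the infimum $A^{\mathrm p*}_{\mathcal G}$ is attained and equals $\sum_{i\in V}w_i/\pi^*_i$, and almost surely the path of the Markov chain lies in $\mathbb T$ and has network peak age $A^{\mathrm p*}_{\mathcal G}$. That is, $\mathbf P$ is peak-age optimal over all trajectories in $\mathbb T$. 3. Let $d_i$ be the number of $j\ne i$ with $(i,j)\in E$, let $P^{\mathrm{rw}}_{i,j}=1/d_i$ if $i\ne j$ and $(i,j)\in E$, and $P^{\mathrm{rw}}_{i,j}=0$ otherwise, and let $\mathbf P^{\mathrm{mh}}$ be the Metropolis–Hastings matrix $$P^{\mathrm{mh}}_{i,j}=\begin{cases}P^{\mathrm{rw}}_{i,j}\min\Big(1,\dfrac{\pi^*_jP^{\mathrm{rw}}_{j,i}}{\pi^*_iP^{\mathrm{rw}}_{i,j}}\Big),&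 i\ne j,\ (i,j)\in E,\\[2mm] 1-\sum_{k\ne i}P^{\mathrm{mh}}_{i,k},& i=j,\\ 0,&\text{otherwise.}\end{cases}$$ Suppose that any two terminals are joined by a path of edges of $G$ that can be used in both directions (for instance, $G$ is symmetric and connected), and that $(i,i)\in E$ whenever $P^{\mathrm{mh}}_{i,i}\neq0$. Then $\mathbf P^{\mathrm{mh}}$ is a randomized trajectory on $G$ with $\pi^*\mathbf P^{\mathrm{mh}}=\pi^*$, and hence is peak-age optimal over all trajectories in the sense of part 2. -/

import Mathlib

open Filter Topology MeasureTheory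

noncomputable section

namespace AgeOfInformation

variable {V : Type*}

/-- The age of terminal `i` under the trajectory `m`, with arbitrary initial ages `a`.
Index `t` stands for the time slot number `t + 1`: the first slot has index `0`. -/
def age [DecidableEq V] (a : V → ℝ) (m : ℕ → V) (i : V) : ℕ → ℝ
  | 0 => a i
  | t + 1 => if m t = i then 1 else age a m i t + 1

/-- Number of the first `T` slots in which the agent is at terminal `i`. -/
def visits [DecidableEq V] (m : ℕ → V) (i : V) (T : ℕ) : ℝ :=
  ∑ t ∈ Finset.range T, if m t = i then 1 else 0

/-- Peak age of terminal `i`, information gathering: the limit superior, as the horizon `T` grows,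
of the average of the ages of `i` over those of the first `T` slots in which the agent is at `i`.
It takes values in the extended reals, so that the limit superior is always the genuine one. -/
def peakAge [DecidableEq V] (a : V → ℝ) (m : ℕ → V) (i : V) : EReal :=
  limsup (fun T : ℕ =>
    (((∑ t ∈ Finset.range T, age a m i t * if m t = i then 1 else 0) / visits m i T : ℝ) : EReal))
    atTop

/-- Network peak age `∑ i, w i * peakAge i`. -/
def networkPeakAge [Fintype V] [DecidableEq V] (w a : V → ℝ) (m : ℕ → V) : EReal :=
  ∑ i, (w i : EReal) * peakAge a m i

/-- The trajectories on the mobility graph `G` along which the fraction of time slots spent at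
each terminal converges to a positive limit. An edge `(i, i)` allows the agent to stay at `i`. -/
def trajectorySpace [DecidableEq V] (G : Digraph V) : Set (ℕ → V) :=
  {m | (∀ t, G.Adj (m t) (m (t + 1))) ∧
    ∀ i, ∃ f : ℝ, 0 < f ∧ Tendsto (fun T : ℕ => visits m i T / (T : ℝ)) atTop (𝓝 f)}

/-- The infimum of the network peak age over the trajectory space. -/
def optimalPeakAge [Fintype V] [DecidableEq V] (G : Digraph V) (w a : V → ℝ) : EReal :=
  sInf (networkPeakAge w a '' trajectorySpace G)

/-- The matrix `P` defines a randomized trajectory on `G`: it is an irreducible transition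
probability matrix that only uses edges of `G`. -/
structure IsRandomizedTrajectory [Fintype V] [DecidableEq V] (G : Digraph V)
    (P : Matrix V V ℝ) : Prop where
  stochastic : P ∈ Matrix.rowStochastic ℝ V
  irreducible : P.IsIrreducible
  support : ∀ i j, ¬ G.Adj i j → P i j = 0

/-- The process `m` is a time-homogeneous Markov chain with transition matrix `P` and arbitrary
initial distribution. The Markov property is multiplied out, to avoid conditioning on
null events. -/
structure IsMarkovChain {Ω : Type*} [MeasurableSpace Ω] (P : Matrix V V ℝ) (μ : Measure Ω)
    (m : ℕ → Ω → V) : Prop where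
  measurableSet_eq : ∀ t i, MeasurableSet {ω | m t ω = i}
  markov : ∀ (t : ℕ) (x : ℕ → V) (j : V),
    μ.real {ω | (∀ k ≤ t, m k ω = x k) ∧ m (t + 1) ω = j} =
      μ.real {ω | ∀ k ≤ t, m k ω = x k} * P (x t) j

/-- The distribution on `V` proportional to the square roots of the weights. -/
def optDist [Fintype V] (w : V → ℝ) (i : V) : ℝ :=
  √(w i) / ∑ j, √(w j)

open Classical in
/-- Out-degree of `i`, the number of terminals other than `i` to which the agent can move. -/
def outDegree [Fintype V] (G : Digraph V) (i : V) : ℕ :=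
  (Finset.univ.filter fun j => j ≠ i ∧ G.Adj i j).card

open Classical in
/-- Transition matrix of the simple random walk on `G`. -/
def randomWalk [Fintype V] (G : Digraph V) : Matrix V V ℝ := fun i j =>
  if i ≠ j ∧ G.Adj i j then 1 / (outDegree G i : ℝ) else 0

open Classical in
/-- Off-diagonal entries of the Metropolis–Hastings matrix (and zero on the diagonal). -/
def mhOffDiag [Fintype V] (G : Digraph V) (w : V → ℝ) (i j : V) : ℝ :=
  if i ≠ j ∧ G.Adj i j then
    randomWalk G i j *
      min 1 ((optDist w j * randomWalk G j i) / (optDist w i * randomWalk G i j))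
  else 0

/-- The Metropolis–Hastings matrix with base chain `randomWalk G` and target `optDist w`. -/
def metropolisHastings [Fintype V] [DecidableEq V] (G : Digraph V) (w : V → ℝ) :
    Matrix V V ℝ := fun i j =>
  if i = j then 1 - ∑ k ∈ Finset.univ.erase i, mhOffDiag G w i k else mhOffDiag G w i j

end AgeOfInformation

end

open Filter Topology MeasureTheory

noncomputable section

namespace AgeOfInformation

/-! ### Peak age in terms of visit frequencies -/

section Deterministic

variable {V : Type*} [DecidableEq V]

/-! The ages at the visits to `i` telescope to `T` minus the current age plus a constant. A positive
visit frequency `f i` makes the current age `o(T)`, so the peak age is `1 / f i`. The network peak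
age is then `∑ w i / f i` with `∑ f i = 1`, and Cauchy–Schwarz bounds it below by `(∑ √(w i)) ^ 2`,
its value at `f = optDist w` (`le_networkPeakAge`). Optimality thus reduces to having visit
frequencies `optDist w`.

Let the discrepancy of a path be the number of moves into `j` minus the sum of the transition
probabilities into `j`. If it is `o(T)`, every cluster point of the empirical frequencies is
stationary for `P`, hence equal to `optDist w` by irreducibility (`tendsto_visits_of_discrepancy`).

Sublinear discrepancy is obtained twice. Along the Markov chain the discrepancy is a martingale with
second moment at most `T`, which gives almost sure sublinearity
(`IsMarkovChain.ae_tendsto_discrepancy`). A deterministic greedy path keeps it of order `√T`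
(`exists_path_discrepancy`), so the infimum is attained without any chain having to exist on `Ω`.
Metropolis–Hastings fits in by detailed balance. -/

lemma visits_succ (m : ℕ → V) (i : V) (T : ℕ) :
    visits m i (T + 1) = visits m i T + if m T = i then 1 else 0 := by
  rw [visits, Finset.sum_range_succ, visits]

lemma visits_nonneg (m : ℕ → V) (i : V) (T : ℕ) : 0 ≤ visits m i T :=
  Finset.sum_nonneg fun _ _ => by split_ifs <;> norm_num

lemma visits_le (m : ℕ → V) (i : V) (T : ℕ) : visits m i T ≤ T := by
  calc visits m i T ≤ ∑ _t ∈ Finset.range T, (1 : ℝ) :=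
        Finset.sum_le_sum fun _ _ => by split_ifs <;> norm_num
    _ = T := by simp

lemma sum_visits [Fintype V] (m : ℕ → V) (T : ℕ) : ∑ i, visits m i T = T := by
  simp only [visits]
  rw [Finset.sum_comm]
  simp

/-- The ages at the visits to `i` telescope. -/
lemma sum_age_mul_visit (a : V → ℝ) (m : ℕ → V) (i : V) (T : ℕ) :
    ∑ t ∈ Finset.range T, age a m i t * (if m t = i then 1 else 0) = T - age a m i T + a i := by
  induction T with
  | zero => simp [age]
  | succ T ih =>
    rw [Finset.sum_range_succ, ih]
    by_cases h : m T = i <;> (simp [age, h]; try ring)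

/-- The number of slots up to and including the last of the first `T` slots spent at `i`
(zero if there is none). -/
def lastVisit (m : ℕ → V) (i : V) : ℕ → ℕ
  | 0 => 0
  | T + 1 => if m T = i then T + 1 else lastVisit m i T

lemma visits_lastVisit (m : ℕ → V) (i : V) (T : ℕ) :
    visits m i (lastVisit m i T) = visits m i T := by
  induction T with
  | zero => rfl
  | succ T ih =>
    by_cases h : m T = i
    · simp [lastVisit, h]
    · simp [lastVisit, h, visits_succ, ih]

/-- Age and time since the last visit both grow by one between visits. Their difference is `a i`
before the first visit and `1` afterwards. -/
lemma abs_age_sub_le (a : V → ℝ) (m : ℕ → V) (i : V) (T : ℕ) :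
    |age a m i T - (T - lastVisit m i T)| ≤ |a i| + 1 := by
  induction T with
  | zero => simp [age, lastVisit]
  | succ T ih =>
    by_cases h : m T = i
    · simp [age, lastVisit, h]
    · simp only [age, lastVisit, h, if_false]
      convert ih using 2
      push_cast
      ring

/-- The visit count is the same at `T` and at the last visit, and its ratio to either time tends to
`f`; the quotient of the two ratios tends to `1`. -/
lemma tendsto_lastVisit_div {m : ℕ → V} {i : V} {f : ℝ} (hf : 0 < f)
    (h : Tendsto (fun T : ℕ => visits m i T / (T : ℝ)) atTop (𝓝 f)) :
    Tendsto (fun T : ℕ => (lastVisit m i T : ℝ) / (T : ℝ)) atTop (𝓝 1) := by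
  have hv : Tendsto (fun T : ℕ => visits m i T) atTop atTop := by
    refine (h.pos_mul_atTop hf tendsto_natCast_atTop_atTop).congr' ?_
    filter_upwards [eventually_gt_atTop 0] with T hT
    have : (T : ℝ) ≠ 0 := by positivity
    field_simp
  have hl : Tendsto (lastVisit m i) atTop atTop := by
    refine tendsto_natCast_atTop_iff (R := ℝ) |>.1 (tendsto_atTop_mono (fun T => ?_) hv)
    rw [← visits_lastVisit]
    exact visits_le m i _
  have h2 := h.div (h.comp hl) hf.ne'
  rw [div_self hf.ne'] at h2
  refine h2.congr' ?_
  filter_upwards [hv.eventually_gt_atTop 0] with T hT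
  simp only [Pi.div_apply, Function.comp, visits_lastVisit]
  field_simp

lemma tendsto_age_div (a : V → ℝ) {m : ℕ → V} {i : V} {f : ℝ} (hf : 0 < f)
    (h : Tendsto (fun T : ℕ => visits m i T / (T : ℝ)) atTop (𝓝 f)) :
    Tendsto (fun T : ℕ => age a m i T / (T : ℝ)) atTop (𝓝 0) := by
  have h1 : Tendsto (fun T : ℕ => (age a m i T - (T - lastVisit m i T)) / (T : ℝ)) atTop
      (𝓝 0) := by
    refine squeeze_zero_norm (fun T => ?_) (tendsto_const_div_atTop_nhds_zero_nat (|a i| + 1))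
    rw [norm_div, Real.norm_eq_abs, Real.norm_natCast]
    gcongr
    exact abs_age_sub_le a m i T
  have h2 := h1.add ((tendsto_lastVisit_div hf h).const_sub 1)
  rw [sub_self, add_zero] at h2
  refine h2.congr' ?_
  filter_upwards [eventually_gt_atTop 0] with T hT
  have : (T : ℝ) ≠ 0 := by positivity
  field_simp
  ring

/-- A terminal visited with frequency `f > 0` has peak age `1 / f`. -/
lemma peakAge_eq_inv (a : V → ℝ) {m : ℕ → V} {i : V} {f : ℝ} (hf : 0 < f)
    (h : Tendsto (fun T : ℕ => visits m i T / (T : ℝ)) atTop (𝓝 f)) :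
    peakAge a m i = ((f⁻¹ : ℝ) : EReal) := by
  unfold peakAge
  refine Tendsto.limsup_eq (continuous_coe_real_ereal.continuousAt.tendsto.comp ?_)
  have h1 := (((tendsto_age_div a hf h).const_sub 1).add
    (tendsto_const_div_atTop_nhds_zero_nat (a i))).div h hf.ne'
  simp only [sub_zero, add_zero, one_div] at h1
  refine h1.congr' ?_
  filter_upwards [eventually_gt_atTop 0] with T hT
  have : (T : ℝ) ≠ 0 := by positivity
  rw [sum_age_mul_visit]
  simp only [Pi.div_apply]
  -- Without visits both sides are `0`, by the convention for division by zero.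
  by_cases hv : visits m i T = 0
  · simp [hv]
  · field_simp

lemma networkPeakAge_eq [Fintype V] (w a : V → ℝ) {m : ℕ → V} {f : V → ℝ} (hf : ∀ i, 0 < f i)
    (h : ∀ i, Tendsto (fun T : ℕ => visits m i T / (T : ℝ)) atTop (𝓝 (f i))) :
    networkPeakAge w a m = ((∑ i, w i / f i : ℝ) : EReal) := by
  unfold networkPeakAge
  have hc : ∀ s : Finset V,
      ((∑ i ∈ s, w i / f i : ℝ) : EReal) = ∑ i ∈ s, ((w i / f i : ℝ) : EReal) :=
    fun s => map_sum (⟨⟨(↑), rfl⟩, EReal.coe_add⟩ : ℝ →+ EReal) _ s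
  rw [hc]
  refine Finset.sum_congr rfl fun i _ => ?_
  rw [peakAge_eq_inv a (hf i) (h i), ← EReal.coe_mul, div_eq_mul_inv]

lemma sum_frequency [Fintype V] {m : ℕ → V} {f : V → ℝ}
    (h : ∀ i, Tendsto (fun T : ℕ => visits m i T / (T : ℝ)) atTop (𝓝 (f i))) :
    ∑ i, f i = 1 := by
  refine tendsto_nhds_unique (tendsto_finsetSum _ fun i _ => h i) ?_
  refine tendsto_const_nhds.congr' ?_
  filter_upwards [eventually_gt_atTop 0] with T hT
  rw [← Finset.sum_div, sum_visits, div_self (by positivity)]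

end Deterministic

/-! ### The Cauchy–Schwarz lower bound -/

section OptDist

variable {V : Type*} [Fintype V] {w : V → ℝ}

lemma sum_sqrt_pos [Nonempty V] (hw : ∀ i, 0 < w i) : 0 < ∑ j, √(w j) :=
  Finset.sum_pos (fun j _ => Real.sqrt_pos.2 (hw j)) Finset.univ_nonempty

lemma optDist_pos [Nonempty V] (hw : ∀ i, 0 < w i) (i : V) : 0 < optDist w i :=
  div_pos (Real.sqrt_pos.2 (hw i)) (sum_sqrt_pos hw)

lemma sum_optDist [Nonempty V] (hw : ∀ i, 0 < w i) : ∑ i, optDist w i = 1 := by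
  simp only [optDist]
  rw [← Finset.sum_div, div_self (sum_sqrt_pos hw).ne']

lemma sum_div_optDist [Nonempty V] (hw : ∀ i, 0 < w i) :
    ∑ i, w i / optDist w i = (∑ i, √(w i)) ^ 2 := by
  rw [sq, Finset.sum_mul]
  refine Finset.sum_congr rfl fun i _ => ?_
  have h1 := Real.sqrt_pos.2 (hw i)
  have h2 := sum_sqrt_pos hw
  rw [optDist, div_div_eq_mul_div, div_eq_iff h1.ne']
  nth_rewrite 1 [← Real.mul_self_sqrt (hw i).le]
  ring

lemma sum_div_optDist_le [Nonempty V] (hw : ∀ i, 0 < w i) {f : V → ℝ} (hf : ∀ i, 0 < f i)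
    (hs : ∑ i, f i = 1) : ∑ i, w i / optDist w i ≤ ∑ i, w i / f i := by
  have h := Finset.sq_sum_div_le_sum_sq_div Finset.univ (fun i => √(w i)) fun i _ => hf i
  rw [hs, div_one] at h
  rw [sum_div_optDist hw]
  exact h.trans_eq (Finset.sum_congr rfl fun i _ => by rw [Real.sq_sqrt (hw i).le])

/-- Lower bound for the network peak age of every trajectory with positive frequencies. -/
lemma le_networkPeakAge [DecidableEq V] [Nonempty V] (hw : ∀ i, 0 < w i) (a : V → ℝ)
    {G : Digraph V} {m : ℕ → V} (hm : m ∈ trajectorySpace G) :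
    ((∑ i, w i / optDist w i : ℝ) : EReal) ≤ networkPeakAge w a m := by
  choose f hf h using hm.2
  rw [networkPeakAge_eq w a hf h, EReal.coe_le_coe_iff]
  exact sum_div_optDist_le hw hf (sum_frequency h)

end OptDist

/-! ### Stationary vectors and convergence of frequencies -/

section Stationary

variable {V : Type*} [Fintype V] [DecidableEq V] {P : Matrix V V ℝ}

lemma vecMul_pow_eq {x : V → ℝ} (hx : Matrix.vecMul x P = x) (k : ℕ) :
    Matrix.vecMul x (P ^ k) = x := by
  induction k with
  | zero => simp
  | succ k ih => rw [pow_succ, ← Matrix.vecMul_vecMul, ih, hx]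

/-- A nonnegative stationary vector of an irreducible matrix vanishes if one entry does. -/
lemma stationary_eq_zero (hP : P.IsIrreducible) {x : V → ℝ} (hx0 : ∀ i, 0 ≤ x i)
    (hx : Matrix.vecMul x P = x) {j : V} (hj : x j = 0) : x = 0 := by
  ext i
  -- The entry `x j = 0` is a sum of nonnegative terms `x l * (P ^ k) l j`, and the term `l = i` has
  -- a positive second factor.
  obtain ⟨k, -, hk⟩ := (Matrix.isIrreducible_iff_exists_pow_pos hP.nonneg).1 hP i j
  have h : ∑ l, x l * (P ^ k) l j = 0 := by
    rw [← hj]; exact congrFun (vecMul_pow_eq hx k) j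
  have h' := (Finset.sum_eq_zero_iff_of_nonneg fun l _ =>
    mul_nonneg (hx0 l) (Matrix.pow_apply_nonneg hP.nonneg k l j)).1 h i (Finset.mem_univ i)
  exact (mul_eq_zero.1 h').resolve_right hk.ne'

/-- Subtracting from `x` the largest multiple of `p` that leaves it nonnegative produces a zero
entry, so nothing is left; equal total mass makes the multiple `1`. -/
lemma stationary_unique [Nonempty V] (hP : P.IsIrreducible) {p x : V → ℝ} (hp : ∀ i, 0 < p i)
    (hpP : Matrix.vecMul p P = p) (hxP : Matrix.vecMul x P = x) (hs : ∑ i, x i = ∑ i, p i) :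
    x = p := by
  obtain ⟨j, hj⟩ := Finite.exists_min fun i => x i / p i
  set c := x j / p j with hc
  have h0 : x - c • p = 0 := by
    refine stationary_eq_zero hP (j := j) (fun i => ?_) ?_ ?_
    · have := (le_div_iff₀ (hp i)).1 (hj i)
      simpa using this
    · rw [Matrix.sub_vecMul, Matrix.smul_vecMul, hpP, hxP]
    · have := (hp j).ne'
      simp only [Pi.sub_apply, Pi.smul_apply, smul_eq_mul, hc]
      field_simp
      simp
  have hx : x = c • p := sub_eq_zero.1 h0
  have hpos : 0 < ∑ i, p i := Finset.sum_pos (fun i _ => hp i) Finset.univ_nonempty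
  have hc1 : c = 1 := by
    rw [hx] at hs
    simp only [Pi.smul_apply, smul_eq_mul, ← Finset.mul_sum] at hs
    exact (mul_eq_right₀ hpos.ne').1 hs
  rw [hx, hc1, one_smul]

/-- Difference between the number of moves into `j` among the first `T` moves and its
compensator. -/
def discrepancy (P : Matrix V V ℝ) (m : ℕ → V) (T : ℕ) (j : V) : ℝ :=
  ∑ t ∈ Finset.range T, ((if m (t + 1) = j then 1 else 0) - P (m t) j)

lemma sum_apply_eq_vecMul_visits (m : ℕ → V) (T : ℕ) (j : V) :
    ∑ t ∈ Finset.range T, P (m t) j = Matrix.vecMul (fun i => visits m i T) P j := by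
  simp only [Matrix.vecMul, dotProduct, visits, Finset.sum_mul]
  rw [Finset.sum_comm]
  simp

/-- Arrivals and occupancies differ only at the two ends of the time window, so the discrepancy is
the defect of stationarity up to a bounded error. -/
lemma visits_sub_vecMul (m : ℕ → V) (T : ℕ) (j : V) :
    visits m j T - Matrix.vecMul (fun i => visits m i T) P j =
      discrepancy P m T j + (if m 0 = j then 1 else 0) - if m T = j then 1 else 0 := by
  have h : ∑ t ∈ Finset.range T, (if m (t + 1) = j then (1 : ℝ) else 0) +
      (if m 0 = j then 1 else 0) = visits m j T + if m T = j then 1 else 0 := by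
    rw [← visits_succ, visits, Finset.sum_range_succ']
  rw [← sum_apply_eq_vecMul_visits, discrepancy, Finset.sum_sub_distrib]
  linarith

/-- If the moves of `m` follow `P` on average, then the visit frequencies of `m` converge to
the stationary distribution of `P`. -/
lemma tendsto_visits_of_discrepancy [Nonempty V] (hP : P.IsIrreducible) {p : V → ℝ}
    (hp : ∀ i, 0 < p i) (hs : ∑ i, p i = 1) (hpP : Matrix.vecMul p P = p) {m : ℕ → V}
    (h : ∀ j, Tendsto (fun T : ℕ => discrepancy P m T j / (T : ℝ)) atTop (𝓝 0)) (i : V) :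
    Tendsto (fun T : ℕ => visits m i T / (T : ℝ)) atTop (𝓝 (p i)) := by
  set x : ℕ → V → ℝ := fun T i => visits m i T / (T : ℝ) with hx
  have hdiff : Tendsto (fun T => x T - Matrix.vecMul (x T) P) atTop (𝓝 0) := by
    refine tendsto_pi_nhds.2 fun j => ?_
    have h1 : Tendsto (fun T : ℕ => ((if m 0 = j then (1 : ℝ) else 0) -
        if m T = j then 1 else 0) / (T : ℝ)) atTop (𝓝 0) := by
      refine squeeze_zero_norm (fun T => ?_) (tendsto_const_div_atTop_nhds_zero_nat 1)
      rw [norm_div, Real.norm_natCast]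
      gcongr
      split_ifs <;> norm_num
    have h2 := (h j).add h1
    rw [add_zero] at h2
    refine h2.congr fun T => ?_
    have hxT : x T = (T : ℝ)⁻¹ • fun i => visits m i T := by
      ext i; simp [hx, div_eq_inv_mul]
    rw [hxT, Matrix.smul_vecMul, ← smul_sub, Pi.smul_apply, Pi.sub_apply, visits_sub_vecMul,
      smul_eq_mul]
    ring
  have hmem : ∀ᶠ T in atTop, x T ∈ stdSimplex ℝ V := by
    filter_upwards [eventually_gt_atTop 0] with T hT
    refine ⟨fun i => div_nonneg (visits_nonneg m i T) (Nat.cast_nonneg T), ?_⟩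
    simp only [hx]
    rw [← Finset.sum_div, sum_visits, div_self (by positivity)]
  have hlim : Tendsto x atTop (𝓝 p) := by
    -- In a compact simplex, convergence follows once `p` is the only possible cluster point;
    -- `hdiff` makes each cluster point stationary.
    refine (isCompact_stdSimplex ℝ V).tendsto_nhds_of_unique_mapClusterPt hmem fun y hy hc => ?_
    have hcont : Continuous fun z : V → ℝ => z - Matrix.vecMul z P := by fun_prop
    have h0 : y - Matrix.vecMul y P = 0 := by
      have hc' : MapClusterPt (y - Matrix.vecMul y P) atTop
          (fun T => x T - Matrix.vecMul (x T) P) := hc.continuousAt_comp hcont.continuousAt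
      exact eq_of_nhds_neBot (hc'.neBot.mono (inf_le_inf_left _ hdiff))
    exact stationary_unique hP hp hpP (sub_eq_zero.1 h0).symm (hy.2.trans hs.symm)
  exact tendsto_pi_nhds.1 hlim i

end Stationary

/-! ### A deterministic path with small discrepancy -/

section Greedy

variable {V : Type*} [Fintype V] [DecidableEq V] {P : Matrix V V ℝ}

lemma apply_le_one (hP : P ∈ Matrix.rowStochastic ℝ V) (i j : V) : P i j ≤ 1 := by
  obtain ⟨h0, h1⟩ := Matrix.mem_rowStochastic_iff_sum.1 hP
  rw [← h1 i]
  exact Finset.single_le_sum (f := fun k => P i k) (fun k _ => h0 i k) (Finset.mem_univ j)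

lemma abs_ite_sub_apply_le_one (hP : P ∈ Matrix.rowStochastic ℝ V) (i j : V) (q : Prop)
    [Decidable q] : |(if q then (1 : ℝ) else 0) - P i j| ≤ 1 := by
  have h0 := hP.1 i j
  have h1 := apply_le_one hP i j
  rw [abs_le]
  split_ifs <;> constructor <;> linarith

omit [Fintype V] in
lemma discrepancy_succ (m : ℕ → V) (T : ℕ) (j : V) :
    discrepancy P m (T + 1) j =
      discrepancy P m T j + ((if m (T + 1) = j then 1 else 0) - P (m T) j) :=
  Finset.sum_range_succ _ T

/-- Some possible move leads to a terminal whose potential is at most the expected one. -/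
lemma exists_pos_le_expectation (hP : P ∈ Matrix.rowStochastic ℝ V) (i : V) (D : V → ℝ) :
    ∃ j, 0 < P i j ∧ D j ≤ ∑ k, P i k * D k := by
  obtain ⟨h0, h1⟩ := Matrix.mem_rowStochastic_iff_sum.1 hP
  by_contra! h
  set c := ∑ k, P i k * D k with hc
  have hlt : ∑ k, P i k * c < ∑ k, P i k * D k := by
    refine Finset.sum_lt_sum (fun k _ => ?_) ?_
    · rcases (h0 i k).eq_or_lt with hk | hk
      · simp [← hk]
      · exact mul_le_mul_of_nonneg_left (h k hk).le hk.le
    · obtain ⟨k, hk, hk'⟩ : ∃ k ∈ Finset.univ, 0 < P i k := by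
        refine Finset.exists_lt_of_sum_lt ?_
        simp [h1 i]
      exact ⟨k, hk, mul_lt_mul_of_pos_left (h k hk') hk'⟩
  rw [← Finset.sum_mul, h1 i, one_mul] at hlt
  exact lt_irrefl _ hlt

/-- The next terminal of the walk that moves so as to balance the discrepancies. -/
def greedyNext (hP : P ∈ Matrix.rowStochastic ℝ V) (i : V) (D : V → ℝ) : V :=
  (exists_pos_le_expectation hP i D).choose

/-- Position and discrepancies of the walk that moves so as to balance the discrepancies. -/
def greedyState (hP : P ∈ Matrix.rowStochastic ℝ V) (i : V) : ℕ → V × (V → ℝ)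
  | 0 => (i, 0)
  | t + 1 =>
    let s := greedyState hP i t
    let j := greedyNext hP s.1 s.2
    (j, fun k => s.2 k + ((if j = k then 1 else 0) - P s.1 k))

lemma greedyState_snd (hP : P ∈ Matrix.rowStochastic ℝ V) (i : V) (T : ℕ) :
    (greedyState hP i T).2 = discrepancy P (fun t => (greedyState hP i t).1) T := by
  induction T with
  | zero => ext j; simp [greedyState, discrepancy]
  | succ T ih =>
    ext j
    rw [discrepancy_succ, ← ih]
    rfl

/-- In the expanded square the cross term is twice `D j - ∑ k, P i k * D k`, which the greedy choice
makes nonpositive, and each squared increment is at most `1`. -/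
lemma sum_sq_add_le (hP : P ∈ Matrix.rowStochastic ℝ V) {i j : V} {D : V → ℝ}
    (h : D j ≤ ∑ k, P i k * D k) :
    ∑ k, (D k + ((if j = k then 1 else 0) - P i k)) ^ 2 ≤ ∑ k, D k ^ 2 + Fintype.card V := by
  have h1 : ∑ k, ((if j = k then (1 : ℝ) else 0) - P i k) ^ 2 ≤ Fintype.card V := by
    calc _ ≤ ∑ _k : V, (1 : ℝ) :=
          Finset.sum_le_sum fun k _ => (sq_le_one_iff_abs_le_one _).2
            (abs_ite_sub_apply_le_one hP i k _)
      _ = _ := by simp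
  have h2 : ∑ k, D k * ((if j = k then (1 : ℝ) else 0) - P i k) = D j - ∑ k, P i k * D k := by
    simp [mul_sub, Finset.sum_sub_distrib, mul_comm]
  have h3 : ∑ k, (D k + ((if j = k then 1 else 0) - P i k)) ^ 2 = ∑ k, D k ^ 2 +
      2 * ∑ k, D k * ((if j = k then (1 : ℝ) else 0) - P i k) +
      ∑ k, ((if j = k then (1 : ℝ) else 0) - P i k) ^ 2 := by
    rw [Finset.mul_sum, ← Finset.sum_add_distrib, ← Finset.sum_add_distrib]
    exact Finset.sum_congr rfl fun k _ => by ring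
  rw [h3, h2]
  linarith

lemma sum_sq_greedyState_le (hP : P ∈ Matrix.rowStochastic ℝ V) (i : V) (T : ℕ) :
    ∑ k, (greedyState hP i T).2 k ^ 2 ≤ T * Fintype.card V := by
  induction T with
  | zero => simp [greedyState]
  | succ T ih =>
    have h := sum_sq_add_le hP (exists_pos_le_expectation hP (greedyState hP i T).1
      (greedyState hP i T).2).choose_spec.2
    refine h.trans ?_
    push_cast
    linarith

/-- There is a path with positive transition probabilities whose moves follow `P` on average. -/
lemma exists_path_discrepancy [Nonempty V] (hP : P ∈ Matrix.rowStochastic ℝ V) :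
    ∃ m : ℕ → V, (∀ t, 0 < P (m t) (m (t + 1))) ∧
      ∀ j, Tendsto (fun T : ℕ => discrepancy P m T j / (T : ℝ)) atTop (𝓝 0) := by
  obtain ⟨i⟩ := ‹Nonempty V›
  refine ⟨fun t => (greedyState hP i t).1, fun t => ?_, fun j => ?_⟩
  · exact (exists_pos_le_expectation hP (greedyState hP i t).1
      (greedyState hP i t).2).choose_spec.1
  · have hlim : Tendsto (fun T : ℕ => √((Fintype.card V : ℝ) / T)) atTop (𝓝 0) := by
      have := (tendsto_const_div_atTop_nhds_zero_nat (Fintype.card V : ℝ)).sqrt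
      rwa [Real.sqrt_zero] at this
    refine squeeze_zero_norm (fun T => Real.abs_le_sqrt ?_) hlim
    rw [← greedyState_snd]
    have h := (Finset.single_le_sum (f := fun k => (greedyState hP i T).2 k ^ 2)
      (fun k _ => sq_nonneg _) (Finset.mem_univ j)).trans (sum_sq_greedyState_le hP i T)
    rcases T.eq_zero_or_pos with rfl | hT
    · simp
    · have hT' : (0 : ℝ) < T := by exact_mod_cast hT
      rw [div_pow, div_le_div_iff₀ (by positivity) hT']
      nlinarith

end Greedy

/-! ### The Metropolis–Hastings chain -/

section MetropolisHastings

variable {V : Type*} [Fintype V] {G : Digraph V} {w : V → ℝ}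

lemma randomWalk_nonneg (G : Digraph V) (i j : V) : 0 ≤ randomWalk G i j := by
  unfold randomWalk
  split_ifs <;> positivity

lemma randomWalk_pos {i j : V} (hij : i ≠ j) (h : G.Adj i j) : 0 < randomWalk G i j := by
  classical
  have : 0 < outDegree G i := by
    unfold outDegree
    exact Finset.card_pos.2 ⟨j, by simp [hij.symm, h]⟩
  unfold randomWalk
  rw [if_pos ⟨hij, h⟩]
  positivity

/-- The sum is `1` unless the out-degree is zero, when the whole row vanishes. -/
lemma sum_randomWalk_le_one (G : Digraph V) (i : V) : ∑ j, randomWalk G i j ≤ 1 := by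
  classical
  have h : ∑ j, randomWalk G i j = outDegree G i * (1 / (outDegree G i : ℝ)) := by
    simp only [randomWalk, outDegree]
    rw [← Finset.sum_filter, Finset.sum_const, nsmul_eq_mul]
    simp only [ne_comm]
  rw [h, mul_one_div]
  exact div_self_le_one _

variable [Nonempty V]

/-- The minimum is symmetric in `i` and `j`, whence detailed balance; it also shows when the entries
are positive. Off the edges both sides are `0`. -/
lemma optDist_mul_mhOffDiag (hw : ∀ i, 0 < w i) (i j : V) :
    optDist w i * mhOffDiag G w i j =
      min (optDist w i * randomWalk G i j) (optDist w j * randomWalk G j i) := by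
  unfold mhOffDiag
  split_ifs with h
  · have hpos := mul_pos (optDist_pos hw i) (randomWalk_pos h.1 h.2)
    rw [← mul_assoc, mul_min_of_nonneg _ _ hpos.le, mul_one, mul_div_cancel₀ _ hpos.ne']
  · have h0 : randomWalk G i j = 0 := by
      unfold randomWalk
      rw [if_neg h]
    rw [h0, mul_zero, min_eq_left]
    exact mul_nonneg (optDist_pos hw j).le (randomWalk_nonneg G j i)

lemma mhOffDiag_nonneg (hw : ∀ i, 0 < w i) (i j : V) : 0 ≤ mhOffDiag G w i j := by
  refine nonneg_of_mul_nonneg_right (a := optDist w i) ?_ (optDist_pos hw i)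
  rw [optDist_mul_mhOffDiag hw]
  exact le_min (mul_nonneg (optDist_pos hw i).le (randomWalk_nonneg G i j))
    (mul_nonneg (optDist_pos hw j).le (randomWalk_nonneg G j i))

lemma mhOffDiag_pos (hw : ∀ i, 0 < w i) {i j : V} (hij : i ≠ j) (h : G.Adj i j)
    (h' : G.Adj j i) : 0 < mhOffDiag G w i j := by
  refine pos_of_mul_pos_right (a := optDist w i) ?_ (optDist_pos hw i).le
  rw [optDist_mul_mhOffDiag hw]
  exact lt_min (mul_pos (optDist_pos hw i) (randomWalk_pos hij h))
    (mul_pos (optDist_pos hw j) (randomWalk_pos hij.symm h'))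

omit [Nonempty V] in
lemma mhOffDiag_le_randomWalk (G : Digraph V) (w : V → ℝ) (i j : V) :
    mhOffDiag G w i j ≤ randomWalk G i j := by
  unfold mhOffDiag
  split_ifs
  · exact mul_le_of_le_one_right (randomWalk_nonneg G i j) (min_le_left _ _)
  · exact randomWalk_nonneg G i j

variable [DecidableEq V]

omit [Nonempty V] in
lemma metropolisHastings_of_ne {i j : V} (hij : i ≠ j) :
    metropolisHastings G w i j = mhOffDiag G w i j := if_neg hij

lemma metropolisHastings_mem_rowStochastic (hw : ∀ i, 0 < w i) :
    metropolisHastings G w ∈ Matrix.rowStochastic ℝ V := by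
  refine Matrix.mem_rowStochastic_iff_sum.2 ⟨fun i j => ?_, fun i => ?_⟩
  · by_cases hij : i = j
    · subst hij
      simp only [metropolisHastings, if_true, sub_nonneg]
      calc ∑ k ∈ Finset.univ.erase i, mhOffDiag G w i k
          ≤ ∑ k, mhOffDiag G w i k :=
            Finset.sum_le_sum_of_subset_of_nonneg (Finset.subset_univ _)
              fun k _ _ => mhOffDiag_nonneg hw i k
        _ ≤ ∑ k, randomWalk G i k :=
            Finset.sum_le_sum fun k _ => mhOffDiag_le_randomWalk G w i k
        _ ≤ 1 := sum_randomWalk_le_one G i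
    · rw [metropolisHastings_of_ne hij]
      exact mhOffDiag_nonneg hw i j
  · rw [← Finset.add_sum_erase _ _ (Finset.mem_univ i)]
    have h : ∑ k ∈ Finset.univ.erase i, metropolisHastings G w i k =
        ∑ k ∈ Finset.univ.erase i, mhOffDiag G w i k :=
      Finset.sum_congr rfl fun k hk => metropolisHastings_of_ne (Finset.ne_of_mem_erase hk).symm
    rw [h]
    simp [metropolisHastings]

/-- Detailed balance. -/
lemma optDist_mul_metropolisHastings (hw : ∀ i, 0 < w i) (i j : V) :
    optDist w i * metropolisHastings G w i j = optDist w j * metropolisHastings G w j i := by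
  by_cases hij : i = j
  · rw [hij]
  · rw [metropolisHastings_of_ne hij, metropolisHastings_of_ne (Ne.symm hij),
      optDist_mul_mhOffDiag hw, optDist_mul_mhOffDiag hw, min_comm]

lemma optDist_vecMul_metropolisHastings (hw : ∀ i, 0 < w i) :
    Matrix.vecMul (optDist w) (metropolisHastings G w) = optDist w := by
  ext j
  simp only [Matrix.vecMul, dotProduct, optDist_mul_metropolisHastings hw _ j]
  rw [← Finset.mul_sum,
    (Matrix.mem_rowStochastic_iff_sum.1 (metropolisHastings_mem_rowStochastic hw)).2 j, mul_one]

omit [Nonempty V] in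
lemma pow_add_apply_pos {M : Matrix V V ℝ} (hM : ∀ i j, 0 ≤ M i j) {i j k : V} {r s : ℕ}
    (h : 0 < (M ^ r) i j) (h' : 0 < (M ^ s) j k) : 0 < (M ^ (r + s)) i k := by
  rw [pow_add, Matrix.mul_apply]
  exact Finset.sum_pos' (fun l _ => mul_nonneg (Matrix.pow_apply_nonneg hM r i l)
    (Matrix.pow_apply_nonneg hM s l k)) ⟨j, Finset.mem_univ j, mul_pos h h'⟩

lemma metropolisHastings_isIrreducible (hw : ∀ i, 0 < w i)
    (hG : ∀ i j, Relation.ReflTransGen (fun k l => G.Adj k l ∧ G.Adj l k) i j) :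
    (metropolisHastings G w).IsIrreducible := by
  have h0 := (metropolisHastings_mem_rowStochastic (G := G) hw).1
  have hex : ∀ i j, ∃ k, 0 < (metropolisHastings G w ^ k) i j := by
    intro i j
    induction hG i j with
    | refl => exact ⟨0, by simp⟩
    | @tail b c _ hbc ih =>
      obtain ⟨k, hk⟩ := ih
      by_cases hne : b = c
      · exact ⟨k, hne ▸ hk⟩
      · refine ⟨k + 1, pow_add_apply_pos h0 hk ?_⟩
        rw [pow_one, metropolisHastings_of_ne hne]
        exact mhOffDiag_pos hw hne hbc.1 hbc.2
  have hne : ∀ i j, i ≠ j → ∃ k > 0, 0 < (metropolisHastings G w ^ k) i j := by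
    intro i j hij
    obtain ⟨k, hk⟩ := hex i j
    refine ⟨k, Nat.pos_of_ne_zero ?_, hk⟩
    rintro rfl
    simp [hij] at hk
  refine (Matrix.isIrreducible_iff_exists_pow_pos h0).2 fun i j => ?_
  by_cases hij : i = j
  · subst hij
    -- A positive power is needed on the diagonal too: go to another terminal and back, or, if there
    -- is none, use the diagonal entry, which is then `1`.
    by_cases hl : ∃ l, i ≠ l
    · obtain ⟨l, hl⟩ := hl
      obtain ⟨r, hr, hr'⟩ := hne i l hl
      obtain ⟨s, -, hs'⟩ := hne l i hl.symm
      exact ⟨r + s, by omega, pow_add_apply_pos h0 hr' hs'⟩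
    · push Not at hl
      refine ⟨1, one_pos, ?_⟩
      have he : (Finset.univ.erase i : Finset V) = ∅ := by
        ext k; simp [hl k]
      simp [metropolisHastings, he]
  · exact hne i j hij

lemma metropolisHastings_isRandomizedTrajectory (hw : ∀ i, 0 < w i)
    (hG : ∀ i j, Relation.ReflTransGen (fun k l => G.Adj k l ∧ G.Adj l k) i j)
    (hd : ∀ i, metropolisHastings G w i i ≠ 0 → G.Adj i i) :
    IsRandomizedTrajectory G (metropolisHastings G w) where
  stochastic := metropolisHastings_mem_rowStochastic hw
  irreducible := metropolisHastings_isIrreducible hw hG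
  support i j h := by
    by_cases hij : i = j
    · subst hij
      exact not_not.1 fun h' => h (hd i h')
    · rw [metropolisHastings_of_ne hij]
      exact if_neg fun h' => h h'.2

end MetropolisHastings

/-- A sequence with bounded increments that is sublinear along the squares is sublinear. -/
lemma tendsto_div_of_tendsto_sq {u : ℕ → ℝ} (hu : ∀ T, |u (T + 1) - u T| ≤ 1)
    (h : Tendsto (fun n : ℕ => u (n ^ 2) / ((n ^ 2 : ℕ) : ℝ)) atTop (𝓝 0)) :
    Tendsto (fun T : ℕ => u T / (T : ℝ)) atTop (𝓝 0) := by
  have hinc : ∀ s k, |u (s + k) - u s| ≤ k := by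
    intro s k
    induction k with
    | zero => simp
    | succ k ih =>
      have := abs_add_le (u (s + k + 1) - u (s + k)) (u (s + k) - u s)
      rw [sub_add_sub_cancel] at this
      rw [← add_assoc]
      push_cast
      linarith [hu (s + k)]
  have hsqrt : Tendsto Nat.sqrt atTop atTop := by
    refine tendsto_atTop.2 fun b => ?_
    filter_upwards [eventually_ge_atTop (b ^ 2)] with T hT
    exact Nat.le_sqrt'.2 hT
  -- With `n = Nat.sqrt T`, the time `T` exceeds `n ^ 2` by at most `2 * n`; relative to `n ^ 2`
  -- this costs `2 / n`.
  have hb : Tendsto (fun n : ℕ => |u (n ^ 2) / ((n ^ 2 : ℕ) : ℝ)| + 2 / (n : ℝ)) atTop (𝓝 0) := by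
    have := h.abs.add (tendsto_const_div_atTop_nhds_zero_nat 2)
    rwa [abs_zero, add_zero] at this
  refine squeeze_zero_norm' ?_ (hb.comp hsqrt)
  filter_upwards [eventually_gt_atTop 0] with T hT
  set n := Nat.sqrt T with hn
  have hn0 : 0 < n := Nat.sqrt_pos.2 hT
  have h1 : n ^ 2 ≤ T := Nat.sqrt_le' T
  have h2 : T ≤ n ^ 2 + 2 * n := by
    have := Nat.sqrt_le_add T
    rw [← hn] at this
    nlinarith
  obtain ⟨k, hT'⟩ := Nat.exists_eq_add_of_le h1
  have hk : (k : ℝ) ≤ 2 * n := by exact_mod_cast (by omega : k ≤ 2 * n)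
  have hn' : (0 : ℝ) < n := by exact_mod_cast hn0
  have h3 := hinc (n ^ 2) k
  have h4 : |u (n ^ 2 + k)| ≤ |u (n ^ 2)| + 2 * n := by
    have := abs_sub_abs_le_abs_sub (u (n ^ 2 + k)) (u (n ^ 2))
    linarith
  simp only [Function.comp, ← hn]
  rw [hT', norm_div, Real.norm_natCast, Real.norm_eq_abs, abs_div, Nat.abs_cast]
  calc |u (n ^ 2 + k)| / ((n ^ 2 + k : ℕ) : ℝ)
      ≤ (|u (n ^ 2)| + 2 * n) / ((n ^ 2 : ℕ) : ℝ) := by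
        gcongr
        omega
    _ = |u (n ^ 2)| / ((n ^ 2 : ℕ) : ℝ) + 2 / n := by
        push_cast
        field_simp

/-! ### Strong law for the discrepancy of the Markov chain -/

section MarkovChain

variable {V Ω : Type*} [Fintype V] [DecidableEq V] [MeasurableSpace Ω] {μ : Measure Ω}
  [IsProbabilityMeasure μ] {P : Matrix V V ℝ} {m : ℕ → Ω → V}

/-- The path that visits `x 0, …, x t` in the first slots. -/
def extendPath {t : ℕ} (x : Fin (t + 1) → V) (k : ℕ) : V := x (Fin.ofNat (t + 1) k)

omit [Fintype V] [DecidableEq V] [MeasurableSpace Ω] in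
lemma extendPath_apply (m : ℕ → Ω → V) (t : ℕ) (ω : Ω) {k : ℕ} (hk : k ≤ t) :
    extendPath (fun l : Fin (t + 1) => m l ω) k = m k ω := by
  simp [extendPath, Nat.mod_eq_of_lt (Nat.lt_succ_of_le hk)]

omit [Fintype V] [DecidableEq V] [MeasurableSpace Ω] in
lemma forall_eq_extendPath_iff (m : ℕ → Ω → V) (t : ℕ) (ω : Ω) (x : Fin (t + 1) → V) :
    (∀ k ≤ t, m k ω = extendPath x k) ↔ (fun l : Fin (t + 1) => m l ω) = x := by
  constructor
  · intro h
    ext l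
    have := h l (Nat.lt_succ_iff.1 l.2)
    simpa [extendPath] using this
  · rintro rfl k hk
    exact (extendPath_apply m t ω hk).symm

omit [Fintype V] [DecidableEq V] [IsProbabilityMeasure μ] in
lemma IsMarkovChain.measurableSet_path (hm : IsMarkovChain P μ m) (t : ℕ) (x : ℕ → V) :
    MeasurableSet {ω | ∀ k ≤ t, m k ω = x k} := by
  simp only [Set.ofPred_forall]
  exact MeasurableSet.iInter fun k => MeasurableSet.iInter fun _ => hm.measurableSet_eq k _

/-- A compensated move is orthogonal to every function of the past. -/
lemma IsMarkovChain.integral_mul_eq_zero (hm : IsMarkovChain P μ m) (t : ℕ) (j : V)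
    (g : (Fin (t + 1) → V) → ℝ) :
    ∫ ω, g (fun l => m l ω) * ((if m (t + 1) ω = j then 1 else 0) - P (m t ω) j) ∂μ = 0 := by
  classical
  let A : (Fin (t + 1) → V) → Set Ω :=
    fun x => {ω | (∀ k ≤ t, m k ω = extendPath x k) ∧ m (t + 1) ω = j}
  let B : (Fin (t + 1) → V) → Set Ω := fun x => {ω | ∀ k ≤ t, m k ω = extendPath x k}
  have hB : ∀ x, MeasurableSet (B x) := fun x => hm.measurableSet_path t _
  have hA : ∀ x, MeasurableSet (A x) := fun x => (hB x).inter (hm.measurableSet_eq (t + 1) j)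
  have hint : ∀ S : Set Ω, MeasurableSet S → Integrable (S.indicator (1 : Ω → ℝ)) μ :=
    fun S hS => (integrable_const (1 : ℝ)).indicator hS
  -- Splitting over the finitely many values `x` of the past makes `g` constant on each piece, where
  -- the Markov property gives mean zero.
  have hsum : ∀ ω, g (fun l => m l ω) * ((if m (t + 1) ω = j then 1 else 0) - P (m t ω) j) =
      ∑ x, g x * ((A x).indicator 1 ω - (B x).indicator 1 ω * P (extendPath x t) j) := by
    intro ω
    rw [Finset.sum_eq_single (fun l : Fin (t + 1) => m l ω)]
    · rw [extendPath_apply m t ω le_rfl]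
      simp only [A, B, Set.indicator_apply, Set.mem_ofPred_eq, forall_eq_extendPath_iff, true_and,
        if_true, one_mul, Pi.one_apply]
    · intro x _ hx
      simp [A, B, forall_eq_extendPath_iff, hx.symm]
    · simp
  simp only [hsum]
  rw [integral_finsetSum _ fun x _ => ?_]
  swap
  · exact ((hint _ (hA x)).sub ((hint _ (hB x)).mul_const _)).const_mul _
  refine Finset.sum_eq_zero fun x _ => ?_
  rw [integral_const_mul, integral_sub (hint _ (hA x)) ((hint _ (hB x)).mul_const _),
    integral_mul_const, integral_indicator_one (hA x), integral_indicator_one (hB x),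
    hm.markov t (extendPath x) j, sub_self, mul_zero]

omit [DecidableEq V] [IsProbabilityMeasure μ] in
lemma IsMarkovChain.measurable_comp (hm : IsMarkovChain P μ m) (t : ℕ) (g : V → ℝ) :
    Measurable fun ω => g (m t ω) := by
  let : MeasurableSpace V := ⊤
  have h : Measurable (m t) := measurable_to_countable' fun i => hm.measurableSet_eq t i
  exact measurable_from_top.comp h

/-- Almost surely the chain makes no move of probability zero. -/
lemma IsMarkovChain.ae_apply_ne_zero (hm : IsMarkovChain P μ m) :
    ∀ᵐ ω ∂μ, ∀ t, P (m t ω) (m (t + 1) ω) ≠ 0 := by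
  have h : ∀ t i j, P i j = 0 → ∀ᵐ ω ∂μ, ¬ (m t ω = i ∧ m (t + 1) ω = j) := by
    intro t i j hij
    have hmeas : MeasurableSet {ω | m t ω = i ∧ m (t + 1) ω = j} :=
      (hm.measurableSet_eq t i).inter (hm.measurableSet_eq (t + 1) j)
    -- On `m t ω = i` the compensator is `P i j = 0`, so this integral is the probability of the
    -- move from `i` to `j`.
    have h0 := hm.integral_mul_eq_zero t j fun x => if x (Fin.last t) = i then 1 else 0
    have h1 : ∀ ω, (if m (Fin.last t) ω = i then (1 : ℝ) else 0) *
        ((if m (t + 1) ω = j then 1 else 0) - P (m t ω) j) =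
        {ω | m t ω = i ∧ m (t + 1) ω = j}.indicator 1 ω := by
      intro ω
      by_cases hi : m t ω = i <;> by_cases hj : m (t + 1) ω = j <;>
        simp [hi, hj, hij]
    simp only [h1] at h0
    rw [integral_indicator_one hmeas, measureReal_eq_zero_iff] at h0
    simpa [ae_iff] using h0
  have h' : ∀ᵐ ω ∂μ, ∀ t i j, P i j = 0 → ¬ (m t ω = i ∧ m (t + 1) ω = j) := by
    simp only [ae_all_iff]
    exact h
  filter_upwards [h'] with ω hω t h0
  exact hω t _ _ h0 ⟨rfl, rfl⟩

omit [IsProbabilityMeasure μ] in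
lemma IsMarkovChain.measurable_discrepancy (hm : IsMarkovChain P μ m) (T : ℕ) (j : V) :
    Measurable fun ω => discrepancy P (fun t => m t ω) T j :=
  Finset.measurable_fun_sum _ fun t _ =>
    (hm.measurable_comp (t + 1) fun i => if i = j then 1 else 0).sub
      (hm.measurable_comp t fun i => P i j)

lemma abs_discrepancy_le (hP : P ∈ Matrix.rowStochastic ℝ V) (x : ℕ → V) (T : ℕ) (j : V) :
    |discrepancy P x T j| ≤ T := by
  calc |discrepancy P x T j| ≤ ∑ t ∈ Finset.range T, (1 : ℝ) :=
        (Finset.abs_sum_le_sum_abs _ _).trans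
          (Finset.sum_le_sum fun t _ => abs_ite_sub_apply_le_one hP _ _ _)
    _ = T := by simp

omit [Fintype V] in
lemma discrepancy_congr {x y : ℕ → V} {T : ℕ} (h : ∀ k ≤ T, x k = y k) (j : V) :
    discrepancy P x T j = discrepancy P y T j := by
  refine Finset.sum_congr rfl fun t ht => ?_
  have ht := Finset.mem_range.1 ht
  rw [h t ht.le, h (t + 1) ht]

lemma IsMarkovChain.integrable_discrepancy_sq (hm : IsMarkovChain P μ m)
    (hP : P ∈ Matrix.rowStochastic ℝ V) (T : ℕ) (j : V) :
    Integrable (fun ω => discrepancy P (fun t => m t ω) T j ^ 2) μ := by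
  refine Integrable.of_bound ((hm.measurable_discrepancy T j).pow_const 2).aestronglyMeasurable
    ((T : ℝ) ^ 2) (ae_of_all _ fun ω => ?_)
  rw [Real.norm_eq_abs, abs_pow]
  exact pow_le_pow_left₀ (abs_nonneg _) (abs_discrepancy_le hP _ T j) 2

/-- Each increment is orthogonal to the past discrepancy and bounded by `1`, so a step adds at most
`1` to the second moment. -/
lemma IsMarkovChain.integral_discrepancy_sq_le (hm : IsMarkovChain P μ m)
    (hP : P ∈ Matrix.rowStochastic ℝ V) (T : ℕ) (j : V) :
    ∫ ω, discrepancy P (fun t => m t ω) T j ^ 2 ∂μ ≤ T := by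
  induction T with
  | zero => simp [discrepancy]
  | succ T ih =>
    set d : Ω → ℝ := fun ω => (if m (T + 1) ω = j then 1 else 0) - P (m T ω) j with hd
    set D : Ω → ℝ := fun ω => discrepancy P (fun t => m t ω) T j with hD
    have hd1 : ∀ ω, |d ω| ≤ 1 := fun ω => abs_ite_sub_apply_le_one hP _ _ _
    have hdm : Measurable d := (hm.measurable_comp (T + 1) fun i => if i = j then 1 else 0).sub
      (hm.measurable_comp T fun i => P i j)
    have horth : ∫ ω, D ω * d ω ∂μ = 0 := by
      have h := hm.integral_mul_eq_zero T j fun x => discrepancy P (extendPath x) T j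
      rw [← h]
      refine integral_congr_ae (ae_of_all _ fun ω => ?_)
      simp only [hD, hd]
      rw [discrepancy_congr fun k hk => (extendPath_apply m T ω hk).symm]
    have hDd : Integrable (fun ω => D ω * d ω) μ := by
      refine Integrable.of_bound ((hm.measurable_discrepancy T j).mul hdm).aestronglyMeasurable
        (T : ℝ) (ae_of_all _ fun ω => ?_)
      rw [Real.norm_eq_abs, abs_mul]
      exact (mul_le_of_le_one_right (abs_nonneg _) (hd1 ω)).trans (abs_discrepancy_le hP _ T j)
    have hD2 : Integrable (fun ω => D ω ^ 2) μ := hm.integrable_discrepancy_sq hP T j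
    have hDd1 : Integrable (fun ω => 2 * (D ω * d ω) + 1) μ :=
      (hDd.const_mul 2).add (integrable_const 1)
    have hle : ∀ ω, discrepancy P (fun t => m t ω) (T + 1) j ^ 2 ≤
        D ω ^ 2 + (2 * (D ω * d ω) + 1) := by
      intro ω
      rw [discrepancy_succ]
      have := (sq_le_one_iff_abs_le_one _).2 (hd1 ω)
      simp only [hD, hd] at this ⊢
      linarith
    calc ∫ ω, discrepancy P (fun t => m t ω) (T + 1) j ^ 2 ∂μ
        ≤ ∫ ω, (D ω ^ 2 + (2 * (D ω * d ω) + 1)) ∂μ :=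
          integral_mono (hm.integrable_discrepancy_sq hP (T + 1) j)
            (hD2.add hDd1) hle
      _ = ∫ ω, D ω ^ 2 ∂μ + 1 := by
          rw [integral_add hD2 hDd1, integral_add (hDd.const_mul 2) (integrable_const 1),
            integral_const_mul, horth]
          simp
      _ ≤ ((T + 1 : ℕ) : ℝ) := by
          push_cast
          linarith

/-- Almost surely the moves of the chain follow `P` on average. -/
lemma IsMarkovChain.ae_tendsto_discrepancy (hm : IsMarkovChain P μ m)
    (hP : P ∈ Matrix.rowStochastic ℝ V) (j : V) :
    ∀ᵐ ω ∂μ, Tendsto (fun T : ℕ => discrepancy P (fun t => m t ω) T j / (T : ℝ)) atTop (𝓝 0) := by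
  -- Along the squares the second moments are at most `1 / n ^ 2`, hence summable: `∑ F n` is almost
  -- surely finite and its terms tend to zero.
  set F : ℕ → Ω → ℝ :=
    fun n ω => (discrepancy P (fun t => m t ω) (n ^ 2) j / ((n ^ 2 : ℕ) : ℝ)) ^ 2 with hF
  have hFm : ∀ n, Measurable (F n) := fun n =>
    ((hm.measurable_discrepancy (n ^ 2) j).div_const _).pow_const 2
  have hbound : ∀ n, ∫⁻ ω, ENNReal.ofReal (F n ω) ∂μ ≤ ENNReal.ofReal (1 / (n : ℝ) ^ 2) := by
    intro n
    have hFe : F n = fun ω => discrepancy P (fun t => m t ω) (n ^ 2) j ^ 2 *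
        (((n ^ 2 : ℕ) : ℝ) ^ 2)⁻¹ := by
      ext ω
      simp only [hF, div_eq_mul_inv, mul_pow, inv_pow]
    have hFi : Integrable (F n) μ := by
      rw [hFe]
      exact (hm.integrable_discrepancy_sq hP (n ^ 2) j).mul_const _
    rw [← ofReal_integral_eq_lintegral_ofReal hFi (ae_of_all _ fun ω => sq_nonneg _)]
    refine ENNReal.ofReal_le_ofReal ?_
    rw [hFe, integral_mul_const]
    refine (mul_le_mul_of_nonneg_right (hm.integral_discrepancy_sq_le hP (n ^ 2) j)
      (by positivity)).trans_eq ?_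
    rcases n.eq_zero_or_pos with rfl | hn
    · simp
    · push_cast
      field_simp
  have hfin : ∫⁻ ω, ∑' n, ENNReal.ofReal (F n ω) ∂μ ≠ ⊤ := by
    rw [lintegral_tsum fun n => (hFm n).ennreal_ofReal.aemeasurable]
    refine ne_top_of_le_ne_top ?_ (ENNReal.tsum_le_tsum hbound)
    rw [← ENNReal.ofReal_tsum_of_nonneg (fun n => by positivity)
      (Real.summable_one_div_nat_pow.2 one_lt_two)]
    exact ENNReal.ofReal_ne_top
  filter_upwards [ae_lt_top (Measurable.tsum fun n => (hFm n).ennreal_ofReal) hfin]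
    with ω hω
  refine tendsto_div_of_tendsto_sq (fun T => ?_) ?_
  · rw [discrepancy_succ, add_sub_cancel_left]
    exact abs_ite_sub_apply_le_one hP _ _ _
  · have h1 : Tendsto (fun n => F n ω) atTop (𝓝 0) := by
      have h := ENNReal.tendsto_atTop_zero_of_tsum_ne_top hω.ne
      have h2 := (ENNReal.tendsto_toReal ENNReal.zero_ne_top).comp h
      refine h2.congr fun n => ?_
      exact ENNReal.toReal_ofReal (sq_nonneg _)
    have h3 := h1.sqrt
    simp only [hF, Real.sqrt_sq_eq_abs, Real.sqrt_zero] at h3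
    exact (tendsto_zero_iff_abs_tendsto_zero _).2 h3

end MarkovChain

/-! ### Optimality -/

section Optimality

variable {V : Type*} [Fintype V] [DecidableEq V] [Nonempty V] {G : Digraph V} {w : V → ℝ}
  {P : Matrix V V ℝ}

/-- A path on `G` whose moves follow `P` on average attains the lower bound. -/
lemma mem_trajectorySpace_of_discrepancy (hw : ∀ i, 0 < w i) (a : V → ℝ)
    (hP : IsRandomizedTrajectory G P) (hstat : Matrix.vecMul (optDist w) P = optDist w)
    {m : ℕ → V} (hpath : ∀ t, P (m t) (m (t + 1)) ≠ 0)
    (h : ∀ j, Tendsto (fun T : ℕ => discrepancy P m T j / (T : ℝ)) atTop (𝓝 0)) :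
    m ∈ trajectorySpace G ∧ networkPeakAge w a m = ((∑ i, w i / optDist w i : ℝ) : EReal) := by
  have hv := tendsto_visits_of_discrepancy hP.irreducible (optDist_pos hw) (sum_optDist hw) hstat h
  refine ⟨⟨fun t => ?_, fun i => ⟨optDist w i, optDist_pos hw i, hv i⟩⟩,
    networkPeakAge_eq w a (optDist_pos hw) hv⟩
  by_contra hadj
  exact hpath t (hP.support _ _ hadj)

/-- The lower bound is attained. -/
lemma isLeast_networkPeakAge (hw : ∀ i, 0 < w i) (a : V → ℝ)
    (hP : IsRandomizedTrajectory G P) (hstat : Matrix.vecMul (optDist w) P = optDist w) :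
    IsLeast (networkPeakAge w a '' trajectorySpace G)
      ((∑ i, w i / optDist w i : ℝ) : EReal) := by
  -- Attainment concerns `G` alone, so the minimizer is the greedy path and not a sample path.
  obtain ⟨m, hpath, hm⟩ := exists_path_discrepancy hP.stochastic
  refine ⟨⟨m, mem_trajectorySpace_of_discrepancy hw a hP hstat (fun t => (hpath t).ne') hm⟩, ?_⟩
  rintro _ ⟨m, hm, rfl⟩
  exact le_networkPeakAge hw a hm

/-- A randomized trajectory with stationary distribution `optDist w` is peak-age optimal. -/
lemma peakAge_optimal (hw : ∀ i, 0 < w i) (a : V → ℝ)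
    {Ω : Type*} [MeasurableSpace Ω] (μ : Measure Ω) [IsProbabilityMeasure μ]
    (hP : IsRandomizedTrajectory G P) (hstat : Matrix.vecMul (optDist w) P = optDist w) :
    IsLeast (networkPeakAge w a '' trajectorySpace G) (optimalPeakAge G w a) ∧
      optimalPeakAge G w a = ((∑ i, w i / optDist w i : ℝ) : EReal) ∧
      ∀ m : ℕ → Ω → V, IsMarkovChain P μ m →
        ∀ᵐ ω ∂μ, (fun t => m t ω) ∈ trajectorySpace G ∧
          networkPeakAge w a (fun t => m t ω) = optimalPeakAge G w a := by
  have hleast := isLeast_networkPeakAge hw a hP hstat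
  have hopt : optimalPeakAge G w a = ((∑ i, w i / optDist w i : ℝ) : EReal) :=
    hleast.isGLB.sInf_eq
  refine ⟨hopt ▸ hleast, hopt, fun m hm => ?_⟩
  filter_upwards [hm.ae_apply_ne_zero,
    ae_all_iff.2 fun j => hm.ae_tendsto_discrepancy hP.stochastic j] with ω h1 h2
  rw [hopt]
  exact mem_trajectorySpace_of_discrepancy hw a hP hstat h1 h2

end Optimality

end AgeOfInformation

end

open AgeOfInformation in
theorem theorem3 {V : Type*} [Fintype V] [DecidableEq V] [Nonempty V] (G : Digraph V)
    (w : V → ℝ) (hw : ∀ i, 0 < w i) (a : V → ℝ)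
    {Ω : Type*} [MeasurableSpace Ω] (μ : MeasureTheory.Measure Ω)
    [MeasureTheory.IsProbabilityMeasure μ] :
    -- lower bound for every trajectory
    (∀ m ∈ trajectorySpace G,
      ((∑ i, w i / optDist w i : ℝ) : EReal) ≤ networkPeakAge w a m) ∧
    -- every randomized trajectory with stationary distribution `optDist w` is optimal
    (∀ P : Matrix V V ℝ, IsRandomizedTrajectory G P →
      Matrix.vecMul (optDist w) P = optDist w →
      IsLeast (networkPeakAge w a '' trajectorySpace G) (optimalPeakAge G w a) ∧
      optimalPeakAge G w a = ((∑ i, w i / optDist w i : ℝ) : EReal) ∧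
      ∀ m : ℕ → Ω → V, IsMarkovChain P μ m →
        ∀ᵐ ω ∂μ, (fun t => m t ω) ∈ trajectorySpace G ∧
          networkPeakAge w a (fun t => m t ω) = optimalPeakAge G w a) ∧
    -- in particular the Metropolis–Hastings one, on a graph connected through two-way edges that
    -- allows the agent to stay wherever the Metropolis–Hastings chain stays
    ((∀ i j, Relation.ReflTransGen (fun k l => G.Adj k l ∧ G.Adj l k) i j) →
      (∀ i, metropolisHastings G w i i ≠ 0 → G.Adj i i) →
      IsRandomizedTrajectory G (metropolisHastings G w) ∧
      Matrix.vecMul (optDist w) (metropolisHastings G w) = optDist w ∧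
      IsLeast (networkPeakAge w a '' trajectorySpace G) (optimalPeakAge G w a) ∧
      optimalPeakAge G w a = ((∑ i, w i / optDist w i : ℝ) : EReal) ∧
      ∀ m : ℕ → Ω → V, IsMarkovChain (metropolisHastings G w) μ m →
        ∀ᵐ ω ∂μ, (fun t => m t ω) ∈ trajectorySpace G ∧
          networkPeakAge w a (fun t => m t ω) = optimalPeakAge G w a) := by
  exact ⟨fun m hm => le_networkPeakAge hw a hm,
    fun P hP hstat => peakAge_optimal hw a μ hP hstat,
    fun hG hd => ⟨metropolisHastings_isRandomizedTrajectory hw hG hd,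
      optDist_vecMul_metropolisHastings hw,
      peakAge_optimal hw a μ (metropolisHastings_isRandomizedTrajectory hw hG hd)
        (optDist_vecMul_metropolisHastings hw)⟩⟩
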